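/- Let $q\in\mathbb{C}$ with $|q|<1$. For $|rs|<1$ let $f(r,s)=\sum_{n=-\infty}^{\infty} r^{n(n+1)/2}s^{n(n-1)/2}$ be Ramanujan's general theta function, and put $\varphi(q)=f(q,q)=\sum_{n=-\infty}^{\infty}q^{n^2}$ and $\psi(q)=f(q,q^3)=\sum_{n=0}^{\infty}q^{n(n+1)/2}$. Let $L(q)=1-24\sum_{m=1}^{\infty}\frac{m q^m}{1-q^m}$ and $L_n=L(q^n)$, and let $$\Gamma_1=\frac{f(q,q^9)}{f(-q,-q^9)},\qquad \Gamma_2=\frac{f(q^3,q^7)}{f(-q^3,-q^7)}.$$ Then $f(-q,-q^9)$, $f(-q^3,-q^7)$, $\varphi(-q^{10})$, $\psi(-q)$ and $\psi(q^5)$ are nonzero, $$\frac1{24}\left[-L_1+L_2+5L_5-5L_{10}\right]=-\frac{\varphi^4(q^5)}{2}+\frac{\varphi^4(-q^{10})}{4}\left(\Gamma_1^2+\Gamma_2^2\right),$$ and, explicitly, $$\frac1{24}\left[-L_1+L_2+5L_5-5L_{10}\right]=-\frac{\varphi^4(q^5)}{2}+\frac{\varphi^4(-q^{10})}{4}\left(\frac{\varphi^4(q)}{4\varphi^4(-q^{10})}+\frac{\varphi^4(q^5)}{4\varphi^4(-q^{10})}-\frac{\varphi^2(q)\varphi^2(q^5)}{2\varphi^4(-q^{10})}+\frac{2\psi(q)\psi(-q^5)}{\psi(-q)\psi(q^5)}\right).$$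 -/

import Mathlib

namespace RamanujanTheta

/-- The `n`-th term `r ^ (n(n+1)/2) * s ^ (n(n-1)/2)` of the bilateral theta series. Both exponents
are nonnegative integers (the integer divisions are exact). -/
noncomputable def thetaTerm (r s : ℂ) (n : ℤ) : ℂ :=
  r ^ (n * (n + 1) / 2) * s ^ (n * (n - 1) / 2)

/-- Ramanujan's general theta function `f(r, s) = ∑_{n ∈ ℤ} r^{n(n+1)/2} s^{n(n-1)/2}`,
for `|r s| < 1`. -/
noncomputable def f (r s : ℂ) : ℂ :=
  ∑' n : ℤ, thetaTerm r s n

/-- `φ(q) = f(q, q)`, that is `∑_{n ∈ ℤ} q^{n²}`. -/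
noncomputable def phi (q : ℂ) : ℂ := f q q

/-- `ψ(q) = f(q, q³)`. -/
noncomputable def psi (q : ℂ) : ℂ := f q (q ^ 3)

/-- Ramanujan's Eisenstein series `L(q) = 1 - 24 ∑_{m ≥ 1} m q^m / (1 - q^m)`, for `|q| < 1`. -/
noncomputable def L (q : ℂ) : ℂ :=
  1 - 24 * ∑' m : ℕ+, (m : ℂ) * q ^ (m : ℕ) / (1 - q ^ (m : ℕ))

/-- `Γ₁ = f(q, q⁹) / f(-q, -q⁹)`. -/
noncomputable def Gamma₁ (q : ℂ) : ℂ := f q (q ^ 9) / f (-q) (-q ^ 9)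

/-- `Γ₂ = f(q³, q⁷) / f(-q³, -q⁷)`. -/
noncomputable def Gamma₂ (q : ℂ) : ℂ := f (q ^ 3) (q ^ 7) / f (-q ^ 3) (-q ^ 7)

/-! The series above converge, so that no `tsum` in the definitions is a default value. -/

theorem thetaTerm_neg (r s : ℂ) (n : ℤ) : thetaTerm r s (-n) = thetaTerm s r n := by
  unfold thetaTerm
  rw [mul_comm, show -n * (-n - 1) = n * (n + 1) by ring, show -n * (-n + 1) = n * (n - 1) by ring]

theorem thetaTerm_succ (r s : ℂ) (n : ℕ) :
    thetaTerm r s ((n + 1 : ℕ) : ℤ) = (r * s) ^ n * r * thetaTerm r s n := by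
  unfold thetaTerm
  obtain ⟨a, ha⟩ : ∃ a : ℕ, ((n : ℤ) * (n - 1)) = 2 * a := by
    obtain ⟨k, hk⟩ := (Int.even_mul_pred_self (n : ℤ)).two_dvd
    have h0 : 0 ≤ (n : ℤ) * (n - 1) := by
      rcases n with _ | n
      · simp
      · have : ((n + 1 : ℕ) : ℤ) - 1 = n := by push_cast; ring
        rw [this]; positivity
    exact ⟨k.toNat, by omega⟩
  have h1 : ((n + 1 : ℕ) : ℤ) * (((n + 1 : ℕ) : ℤ) + 1) / 2 = ((a + n + n + 1 : ℕ) : ℤ) := by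
    have : ((n + 1 : ℕ) : ℤ) * (((n + 1 : ℕ) : ℤ) + 1) = 2 * ((a + n + n + 1 : ℕ) : ℤ) := by
      push_cast; linarith
    omega
  have h2 : ((n + 1 : ℕ) : ℤ) * (((n + 1 : ℕ) : ℤ) - 1) / 2 = ((a + n : ℕ) : ℤ) := by
    have : ((n + 1 : ℕ) : ℤ) * (((n + 1 : ℕ) : ℤ) - 1) = 2 * ((a + n : ℕ) : ℤ) := by
      push_cast; linarith
    omega
  have h3 : (n : ℤ) * (n + 1) / 2 = ((a + n : ℕ) : ℤ) := by
    have : (n : ℤ) * (n + 1) = 2 * ((a + n : ℕ) : ℤ) := by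
      push_cast; linarith
    omega
  have h4 : (n : ℤ) * (n - 1) / 2 = (a : ℤ) := by omega
  rw [h1, h2, h3, h4]
  simp only [zpow_natCast]
  ring

theorem summable_thetaTerm_nat {r s : ℂ} (h : ‖r * s‖ < 1) :
    Summable fun n : ℕ => thetaTerm r s n := by
  refine summable_of_ratio_norm_eventually_le (r := 1 / 2) (by norm_num) ?_
  have hlim : Filter.Tendsto (fun n : ℕ => ‖(r * s) ^ n * r‖) Filter.atTop (nhds 0) := by
    simpa using! ((tendsto_pow_atTop_nhds_zero_of_norm_lt_one h).mul_const r).norm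
  filter_upwards [hlim.eventually (ge_mem_nhds (show (0 : ℝ) < 1 / 2 by norm_num))] with n hn
  rw [thetaTerm_succ, norm_mul]
  gcongr

theorem summable_thetaTerm {r s : ℂ} (h : ‖r * s‖ < 1) : Summable (thetaTerm r s) := by
  refine Summable.of_nat_of_neg (summable_thetaTerm_nat h) ?_
  simp only [thetaTerm_neg]
  exact summable_thetaTerm_nat (by rwa [mul_comm])

theorem summable_L {q : ℂ} (h : ‖q‖ < 1) :
    Summable fun m : ℕ+ => (m : ℂ) * q ^ (m : ℕ) / (1 - q ^ (m : ℕ)) := by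
  have := (summable_norm_pow_mul_geometric_div_one_sub 1 h).comp_injective PNat.coe_injective
  simpa [Function.comp_def] using this

theorem phi_eq_tsum (q : ℂ) : phi q = ∑' n : ℤ, q ^ (n ^ 2) := by
  unfold phi f
  congr 1
  funext n
  unfold thetaTerm
  obtain ⟨a, ha⟩ := (Int.even_mul_succ_self n).two_dvd
  obtain ⟨b, hb⟩ := (Int.even_mul_pred_self n).two_dvd
  have ha0 : 0 ≤ a := by nlinarith [Int.le_self_sq n, Int.le_self_sq (-n)]
  have hb0 : 0 ≤ b := by nlinarith [Int.le_self_sq n, Int.le_self_sq (-n)]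
  lift a to ℕ using ha0
  lift b to ℕ using hb0
  have hab : n ^ 2 = ((a + b : ℕ) : ℤ) := by push_cast; linarith
  have h1 : n * (n + 1) / 2 = (a : ℤ) := by omega
  have h2 : n * (n - 1) / 2 = (b : ℤ) := by omega
  rw [h1, h2, hab]
  simp only [zpow_natCast]
  ring

end RamanujanTheta

open Filter Topology

namespace RamanujanTheta

/-! Put p = q^10 and Λ(z) = ∑ 2 z^n / (1 + p^n), summed over all integers n. Everything is read off
from the values of Λ at q, q^3 and q^5.

Multiplying Λ(z) by the theta series f(-z, -p/z) gives coefficients that obey the recurrence of f(z,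
p/z), so Λ(z) is a constant times f(z, p/z) / f(-z, -p/z) (`exists_theta_mul_lambert`). Jacobi's
two-square theorem (`lambert_eq_phi_sq`) fixes the constant as φ(-p)^2. Hence Λ(q) = φ(-p)^2 Γ₁,
Λ(q^3) = φ(-p)^2 Γ₂ and Λ(q^5) = φ(q^5)^2.

By partial fractions and telescoping, Λ(z)^2 = C + ∑ 4N z^N / (1 - p^N) over N ≠ 0, with C
independent of z (`exists_hasSum_lambert_sq`). In Λ(q)^2 + Λ(q^3)^2 - 2Λ(q^5)^2 the constant cancels
and the Eisenstein combination remains (`eisenstein_eq_lambert`).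

The explicit form uses Γ₁^2 + Γ₂^2 = (Γ₁ - Γ₂)^2 + 2Γ₁Γ₂. The difference comes from
`lambert_sub_lambert`, the product from the triple product (`Gamma_mul_Gamma`). -/

/-! ### The Jacobi triple product as a limit of the finite q-binomial theorem. -/

theorem tri_succ (n : ℤ) : (n + 1) * n / 2 = n * (n - 1) / 2 + n := by
  have : (n + 1) * n = n * (n - 1) + n * 2 := by ring
  rw [this, Int.add_mul_ediv_right _ _ (by norm_num)]

theorem thetaTerm_add_one {r s : ℂ} (hr : r ≠ 0) (hs : s ≠ 0) (n : ℤ) :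
    thetaTerm r s (n + 1) = r * (r * s) ^ n * thetaTerm r s n := by
  unfold thetaTerm
  have h1 : (n + 1) * (n + 1 + 1) / 2 = n * (n + 1) / 2 + (n + 1) := by
    have := tri_succ (n + 1)
    rw [mul_comm (n + 1) (n + 1 + 1), this, add_sub_cancel_right, mul_comm (n + 1) n]
  have h2 : (n + 1) * (n + 1 - 1) / 2 = n * (n - 1) / 2 + n := by
    rw [add_sub_cancel_right, tri_succ]
  rw [h1, h2, zpow_add₀ hr, zpow_add₀ hs, zpow_add_one₀ hr, mul_zpow]
  ring

theorem thetaTerm_zero (r s : ℂ) : thetaTerm r s 0 = 1 := by simp [thetaTerm]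

/-- The finite `q`-factorial `∏_{1 ≤ i ≤ n} (1 - p^i)`. -/
noncomputable def qfac (p : ℂ) (n : ℕ) : ℂ := ∏ i ∈ Finset.range n, (1 - p ^ (i + 1))

/-- Gaussian binomial coefficients. -/
noncomputable def gauss (p : ℂ) : ℕ → ℕ → ℂ
  | _, 0 => 1
  | 0, _ + 1 => 0
  | n + 1, k + 1 => gauss p n k + p ^ (k + 1) * gauss p n (k + 1)

theorem gauss_zero_right (p : ℂ) (n : ℕ) : gauss p n 0 = 1 := by cases n <;> rfl

theorem gauss_succ_succ (p : ℂ) (n k : ℕ) :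
    gauss p (n + 1) (k + 1) = gauss p n k + p ^ (k + 1) * gauss p n (k + 1) := rfl

theorem gauss_eq_zero (p : ℂ) : ∀ {n k : ℕ}, n < k → gauss p n k = 0
  | 0, _ + 1, _ => rfl
  | n + 1, k + 1, h => by
    rw [gauss_succ_succ, gauss_eq_zero p (by omega : n < k),
      gauss_eq_zero p (by omega : n < k + 1)]
    simp

theorem gauss_self (p : ℂ) : ∀ n : ℕ, gauss p n n = 1
  | 0 => rfl
  | n + 1 => by rw [gauss_succ_succ, gauss_self p n, gauss_eq_zero p (Nat.lt_succ_self n)]; simp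

theorem qfac_zero (p : ℂ) : qfac p 0 = 1 := by simp [qfac]

theorem qfac_succ (p : ℂ) (n : ℕ) : qfac p (n + 1) = qfac p n * (1 - p ^ (n + 1)) := by
  simp [qfac, Finset.prod_range_succ]

theorem gauss_mul_qfac (p : ℂ) : ∀ n i j : ℕ, i + j = n →
    gauss p n j * qfac p i * qfac p j = qfac p n := by
  intro n
  induction n with
  | zero =>
    intro i j h
    obtain ⟨rfl, rfl⟩ : i = 0 ∧ j = 0 := by omega
    simp [gauss_zero_right, qfac_zero]
  | succ n ih =>
    intro i j h
    rcases i with _ | i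
    · obtain rfl : j = n + 1 := by omega
      simp [gauss_self, qfac_zero]
    rcases j with _ | j
    · obtain rfl : i = n := by omega
      simp [gauss_zero_right, qfac_zero]
    have h1 := ih (i + 1) j (by omega)
    have h2 := ih i (j + 1) (by omega)
    have hp : p ^ (n + 1) = p ^ (j + 1) * p ^ (i + 1) := by rw [← pow_add]; congr 1; omega
    calc gauss p (n + 1) (j + 1) * qfac p (i + 1) * qfac p (j + 1)
        = (gauss p n j * qfac p (i + 1) * qfac p j) * (1 - p ^ (j + 1))
          + p ^ (j + 1) * (1 - p ^ (i + 1)) * (gauss p n (j + 1) * qfac p i * qfac p (j + 1)) := by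
          rw [gauss_succ_succ, qfac_succ p i, qfac_succ p j]; ring
      _ = qfac p (n + 1) := by rw [h1, h2, qfac_succ, hp]; ring

theorem one_sub_pow_ne_zero {p : ℂ} (hp : ‖p‖ < 1) (n : ℕ) : 1 - p ^ (n + 1) ≠ 0 := by
  intro h
  have : ‖p ^ (n + 1)‖ < 1 := by
    rw [norm_pow]; exact pow_lt_one₀ (norm_nonneg _) hp (by omega)
  rw [← sub_eq_zero.mp h] at this
  simp at this

theorem qfac_ne_zero {p : ℂ} (hp : ‖p‖ < 1) (n : ℕ) : qfac p n ≠ 0 :=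
  Finset.prod_ne_zero_iff.mpr fun i _ => one_sub_pow_ne_zero hp i

theorem gauss_eq_div {p : ℂ} (hp : ‖p‖ < 1) {n i j : ℕ} (h : i + j = n) :
    gauss p n j = qfac p n * (qfac p i)⁻¹ * (qfac p j)⁻¹ := by
  have := gauss_mul_qfac p n i j h
  have h1 := qfac_ne_zero hp i
  have h2 := qfac_ne_zero hp j
  rw [← this]; field_simp

theorem gauss_symm {p : ℂ} (hp : ‖p‖ < 1) {n i j : ℕ} (h : i + j = n) :
    gauss p n i = gauss p n j := by
  rw [gauss_eq_div hp h, gauss_eq_div hp (by omega : j + i = n)]; ring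

/-- The q-Pascal rule: multiplying by r p^M raises the theta index by one at the cost of a weight
p^j. Here A counts all factors and M only those in r, so the step applies whatever the number of
factors in s. -/
theorem sum_gauss_thetaTerm_succ {r s : ℂ} (hr : r ≠ 0) (hs : s ≠ 0) (A M : ℕ) :
    ∑ j ∈ Finset.range (A + 2), gauss (r * s) (A + 1) j * thetaTerm r s ((M + 1 : ℕ) - j)
      = (1 + r * (r * s) ^ M) *
        ∑ j ∈ Finset.range (A + 1), gauss (r * s) A j * thetaTerm r s (M - j) := by
  have hp : r * s ≠ 0 := mul_ne_zero hr hs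
  have key : ∑ j ∈ Finset.range (A + 2),
      (r * s) ^ j * gauss (r * s) A j * thetaTerm r s ((M + 1 : ℕ) - j)
      = ∑ j ∈ Finset.range (A + 1),
        r * (r * s) ^ M * (gauss (r * s) A j * thetaTerm r s (M - j)) := by
    rw [Finset.sum_range_succ, gauss_eq_zero _ (Nat.lt_succ_self A)]
    simp only [mul_zero, zero_mul, add_zero]
    refine Finset.sum_congr rfl fun j _ => ?_
    have : ((M + 1 : ℕ) : ℤ) - j = ((M : ℤ) - j) + 1 := by push_cast; ring
    rw [this, thetaTerm_add_one hr hs, zpow_sub₀ hp, zpow_natCast, zpow_natCast]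
    field_simp
  rw [Finset.sum_range_succ'] at key ⊢
  rw [add_mul, one_mul, Finset.mul_sum, ← key, gauss_zero_right, gauss_zero_right]
  simp only [gauss_succ_succ, add_mul, Finset.sum_add_distrib]
  have : ∀ j : ℕ, (((M + 1 : ℕ) : ℤ) - ((j + 1 : ℕ) : ℤ)) = (M : ℤ) - j := by
    intro j; push_cast; ring
  simp only [this]
  ring

theorem prod_mul_prod_eq_sum_gauss {r s : ℂ} (hr : r ≠ 0) (hs : s ≠ 0) (h : ‖r * s‖ < 1)
    (M N : ℕ) :
    (∏ k ∈ Finset.range M, (1 + r * (r * s) ^ k)) * ∏ k ∈ Finset.range N, (1 + s * (r * s) ^ k)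
      = ∑ j ∈ Finset.range (M + N + 1), gauss (r * s) (M + N) j * thetaTerm r s (M - j) := by
  -- With the roles of r and s exchanged this is the base case M = 0. The sum is then reversed by
  -- the symmetry of Gaussian coefficients.
  have single : ∀ {r s : ℂ}, r ≠ 0 → s ≠ 0 → ∀ M : ℕ,
      ∏ k ∈ Finset.range M, (1 + r * (r * s) ^ k)
        = ∑ j ∈ Finset.range (M + 1), gauss (r * s) M j * thetaTerm r s (M - j) := by
    intro r s hr hs M
    induction M with
    | zero => simp [gauss_zero_right, thetaTerm_zero]
    | succ M ih => rw [sum_gauss_thetaTerm_succ hr hs, ← ih, Finset.prod_range_succ]; ring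
  induction M with
  | zero =>
    have := single hs hr N
    rw [mul_comm s r] at this
    rw [Finset.prod_range_zero, one_mul, this, ← Finset.sum_range_reflect]
    simp only [zero_add]
    refine Finset.sum_congr rfl fun j hj => ?_
    have hj' : j ≤ N := by simpa [Nat.lt_succ_iff] using hj
    have e : N + 1 - 1 - j = N - j := by omega
    rw [e, gauss_symm h (Nat.sub_add_cancel hj'), ← thetaTerm_neg, Nat.cast_sub hj']
    congr 2; push_cast; ring
  | succ M ih =>
    rw [show M + 1 + N = (M + N) + 1 by ring, sum_gauss_thetaTerm_succ hr hs, ← ih,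
      Finset.prod_range_succ]
    ring

theorem summable_norm_mul_pow {p : ℂ} (hp : ‖p‖ < 1) (a : ℂ) :
    Summable fun k : ℕ => ‖a * p ^ k‖ := by
  simp only [norm_mul, norm_pow]
  exact (summable_geometric_of_lt_one (norm_nonneg _) hp).mul_left _

theorem exists_tendsto_prod {p : ℂ} (hp : ‖p‖ < 1) {a : ℂ} (ha : ∀ k : ℕ, 1 + a * p ^ k ≠ 0) :
    ∃ l : ℂ, l ≠ 0 ∧
      Tendsto (fun n => ∏ k ∈ Finset.range n, (1 + a * p ^ k)) atTop (𝓝 l) :=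
  ⟨_, tprod_one_add_ne_zero_of_summable ha (summable_norm_mul_pow hp a),
    (multipliable_one_add_of_summable (summable_norm_mul_pow hp a)).hasProd.tendsto_prod_nat⟩

theorem exists_tendsto_qfac {p : ℂ} (hp : ‖p‖ < 1) :
    ∃ l : ℂ, l ≠ 0 ∧ Tendsto (qfac p) atTop (𝓝 l) := by
  have e : ∀ k : ℕ, 1 + -p * p ^ k = 1 - p ^ (k + 1) := fun k => by ring
  obtain ⟨l, hl, h⟩ := exists_tendsto_prod hp (a := -p)
    (fun k => by rw [e]; exact one_sub_pow_ne_zero hp k)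
  simp only [e] at h
  exact ⟨l, hl, h⟩

/-- The q-factorials converge to a nonzero limit, so they and their inverses are bounded. The
uniform bound serves as domination in the passage to the triple product. -/
theorem exists_norm_gauss_le {p : ℂ} (hp : ‖p‖ < 1) :
    ∃ B : ℝ, ∀ n k : ℕ, ‖gauss p n k‖ ≤ B := by
  obtain ⟨l, hl, h⟩ := exists_tendsto_qfac hp
  obtain ⟨B₁, hB₁⟩ := h.norm.bddAbove_range
  obtain ⟨B₂, hB₂⟩ := (h.inv₀ hl).norm.bddAbove_range
  have h1 : ∀ n, ‖qfac p n‖ ≤ B₁ := fun n => hB₁ ⟨n, rfl⟩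
  have h2 : ∀ n, ‖(qfac p n)⁻¹‖ ≤ B₂ := fun n => hB₂ ⟨n, rfl⟩
  have hB₁0 : 0 ≤ B₁ := (norm_nonneg _).trans (h1 0)
  have hB₂0 : 0 ≤ B₂ := (norm_nonneg _).trans (h2 0)
  refine ⟨B₁ * B₂ * B₂, fun n k => ?_⟩
  rcases lt_or_ge n k with hk | hk
  · rw [gauss_eq_zero p hk, norm_zero]; positivity
  · rw [gauss_eq_div hp (Nat.sub_add_cancel hk), norm_mul, norm_mul]
    gcongr
    exacts [h1 _, h2 _, h2 _]

/-- Jacobi's triple product identity, with partial products. -/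
theorem exists_tendsto_prod_theta {p : ℂ} (hp : ‖p‖ < 1) :
    ∃ l : ℂ, l ≠ 0 ∧ ∀ r s : ℂ, r ≠ 0 → s ≠ 0 → r * s = p →
      Tendsto (fun N => ∏ k ∈ Finset.range N, ((1 + r * p ^ k) * (1 + s * p ^ k))) atTop
        (𝓝 (l * f r s)) := by
  obtain ⟨l, hl, hlim⟩ := exists_tendsto_qfac hp
  obtain ⟨B, hB⟩ := exists_norm_gauss_le hp
  -- The constant is the inverse of ∏ (1 - p^i), hence the same for every factorisation r s = p.
  refine ⟨l⁻¹, inv_ne_zero hl, ?_⟩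
  rintro r s hr hs rfl
  -- Extending the coefficients by zero outside [-N, N] puts all the finite sums over ℤ, ready for
  -- dominated convergence.
  set G : ℕ → ℤ → ℂ := fun N n =>
    if n ∈ Finset.Icc (-(N : ℤ)) N then gauss (r * s) (N + N) (N - n).toNat else 0 with hG
  have hsum : ∀ N : ℕ, ∏ k ∈ Finset.range N, ((1 + r * (r * s) ^ k) * (1 + s * (r * s) ^ k))
      = ∑' n : ℤ, G N n * thetaTerm r s n := by
    intro N
    rw [Finset.prod_mul_distrib, prod_mul_prod_eq_sum_gauss hr hs hp,
      tsum_eq_sum (s := Finset.Icc (-(N : ℤ)) N)]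
    · refine Finset.sum_nbij' (fun j : ℕ => (N : ℤ) - j) (fun n => (N - n).toNat) ?_ ?_ ?_ ?_ ?_
      · intro j hj; simp at hj ⊢; omega
      · intro j hj; simp at hj ⊢; omega
      · intro j hj; simp
      · intro n hn; simp at hn; simp; omega
      · intro j hj
        have hj' : (N : ℤ) - j ∈ Finset.Icc (-(N : ℤ)) N := by simp at hj ⊢; omega
        simp only [hG, if_pos hj']
        simp
    · intro n hn; simp only [hG, if_neg hn, zero_mul]
  simp only [hsum]
  have hf : l⁻¹ * f r s = ∑' n : ℤ, l⁻¹ * thetaTerm r s n := by rw [f, tsum_mul_left]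
  rw [hf]
  have hB0 : 0 ≤ B := (norm_nonneg _).trans (hB 0 0)
  refine tendsto_tsum_of_dominated_convergence (bound := fun n => B * ‖thetaTerm r s n‖)
    ((summable_thetaTerm hp).norm.mul_left B) ?_ ?_
  · intro n
    refine Tendsto.mul_const _ ?_
    have h1 : Tendsto (fun N : ℕ => N + N) atTop atTop :=
      tendsto_atTop_mono (fun N => by omega : ∀ N : ℕ, N ≤ N + N) tendsto_id
    have h2 : Tendsto (fun N : ℕ => ((N : ℤ) - n).toNat) atTop atTop :=
      tendsto_atTop.2 fun b => by
        filter_upwards [eventually_ge_atTop (b + n.natAbs)] with N hN; omega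
    have h3 : Tendsto (fun N : ℕ => ((N : ℤ) + n).toNat) atTop atTop :=
      tendsto_atTop.2 fun b => by
        filter_upwards [eventually_ge_atTop (b + n.natAbs)] with N hN; omega
    have := ((hlim.comp h1).mul ((hlim.comp h3).inv₀ hl)).mul ((hlim.comp h2).inv₀ hl)
    rw [mul_inv_cancel₀ hl, one_mul] at this
    refine this.congr' ?_
    filter_upwards [eventually_ge_atTop n.natAbs] with N hN
    have hn : n ∈ Finset.Icc (-(N : ℤ)) N := by simp; omega
    simp only [hG, if_pos hn, Function.comp]
    rw [gauss_eq_div hp (i := ((N : ℤ) + n).toNat)]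
    simp at hn; omega
  · refine Eventually.of_forall fun N n => ?_
    rw [norm_mul]
    gcongr
    simp only [hG]
    split_ifs
    · exact hB _ _
    · simpa using hB0

theorem one_add_mul_pow_ne_zero {a p : ℂ} (ha : ‖a‖ < 1) (hp : ‖p‖ < 1) (k : ℕ) :
    1 + a * p ^ k ≠ 0 := by
  intro h
  have h1 : ‖a * p ^ k‖ < 1 := by
    rw [norm_mul, norm_pow]
    exact (mul_le_of_le_one_right (norm_nonneg _)
      (pow_le_one₀ (norm_nonneg _) hp.le)).trans_lt ha
  rw [show a * p ^ k = -1 by linear_combination h] at h1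
  simp at h1

/-- By the triple product, f(r, s) is a nonzero constant times a convergent product, none of whose
factors vanishes inside the unit disc. -/
theorem f_ne_zero {r s : ℂ} (hr0 : r ≠ 0) (hs0 : s ≠ 0) (hr : ‖r‖ < 1) (hs : ‖s‖ < 1) :
    f r s ≠ 0 := by
  have hp : ‖r * s‖ < 1 := by
    rw [norm_mul]; exact mul_lt_one_of_nonneg_of_lt_one_left (norm_nonneg _) hr hs.le
  obtain ⟨l, -, h⟩ := exists_tendsto_prod_theta hp
  obtain ⟨a, ha, h1⟩ := exists_tendsto_prod hp (one_add_mul_pow_ne_zero hr hp)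
  obtain ⟨b, hb, h2⟩ := exists_tendsto_prod hp (one_add_mul_pow_ne_zero hs hp)
  have h3 := h1.mul h2
  simp only [← Finset.prod_mul_distrib] at h3
  have := tendsto_nhds_unique h3 (h r s hr0 hs0 rfl)
  exact right_ne_zero_of_mul (this ▸ mul_ne_zero ha hb)

/-! ### Quadratic identities for φ. -/

theorem thetaTerm_self {t : ℂ} (ht : t ≠ 0) (n : ℤ) : thetaTerm t t n = t ^ (n ^ 2) := by
  unfold thetaTerm
  rw [← zpow_add₀ ht]
  congr 1
  have := tri_succ n
  rw [mul_comm (n + 1) n] at this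
  obtain ⟨k, hk⟩ := (Int.even_mul_pred_self n).two_dvd
  rw [this, hk, Int.mul_ediv_cancel_left _ (by norm_num)]
  linear_combination -hk

theorem norm_sq_lt_one {t : ℂ} (ht : ‖t‖ < 1) : ‖t ^ 2‖ < 1 := by
  rw [norm_pow]; exact pow_lt_one₀ (norm_nonneg _) ht (by norm_num)

theorem summable_norm_zpow_sq {t : ℂ} (ht0 : t ≠ 0) (ht : ‖t‖ < 1) :
    Summable fun n : ℤ => ‖t ^ (n ^ 2)‖ := by
  simp only [← thetaTerm_self ht0]
  exact (summable_thetaTerm (by rw [← pow_two]; exact norm_sq_lt_one ht)).norm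

theorem neg_one_zpow_sq (n : ℤ) : (-1 : ℂ) ^ (n ^ 2) = (-1) ^ n := by
  rcases Int.even_or_odd n with h | h
  · rw [h.neg_one_zpow, (h.pow_of_ne_zero (by norm_num)).neg_one_zpow]
  · rw [h.neg_one_zpow, (h.pow).neg_one_zpow]

theorem neg_zpow_eq (t : ℂ) (n : ℤ) : (-t) ^ n = (-1) ^ n * t ^ n := by
  rw [neg_eq_neg_one_mul, mul_zpow]

/-- The weight kills the pairs with odd sum and doubles the others, which are exactly the pairs (a +
b, a - b). -/
theorem tsum_even_sum (h : ℤ × ℤ → ℂ) :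
    ∑' x : ℤ × ℤ, (1 + (-1) ^ (x.1 + x.2)) * h x
      = 2 * ∑' x : ℤ × ℤ, h (x.1 + x.2, x.1 - x.2) := by
  have hinj : Function.Injective fun x : ℤ × ℤ => (x.1 + x.2, x.1 - x.2) := by
    rintro ⟨a, b⟩ ⟨c, d⟩ hx
    simp only [Prod.mk.injEq] at hx ⊢
    omega
  rw [← hinj.tsum_eq, ← tsum_mul_left]
  · refine tsum_congr fun x => ?_
    have : Even (x.1 + x.2 + (x.1 - x.2)) := ⟨x.1, by ring⟩
    simp only [this.neg_one_zpow]
    norm_num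
  · rintro ⟨m, n⟩ hx
    rcases Int.even_or_odd (m + n) with ⟨k, hk⟩ | ho
    · exact ⟨(k, m - k), by simp; omega⟩
    · exact absurd (by simp [ho.neg_one_zpow]) hx

theorem phi_sq_add_phi_neg_sq {t : ℂ} (ht0 : t ≠ 0) (ht : ‖t‖ < 1) :
    phi t ^ 2 + phi (-t) ^ 2 = 2 * phi (t ^ 2) ^ 2 := by
  have s1 := summable_norm_zpow_sq ht0 ht
  have s2 := summable_norm_zpow_sq (neg_ne_zero.mpr ht0) (by rwa [norm_neg])
  have s3 := summable_norm_zpow_sq (pow_ne_zero 2 ht0) (norm_sq_lt_one ht)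
  simp only [phi_eq_tsum, pow_two (tsum _)]
  rw [tsum_mul_tsum_of_summable_norm s1 s1, tsum_mul_tsum_of_summable_norm s2 s2,
    tsum_mul_tsum_of_summable_norm s3 s3, ← (summable_mul_of_summable_norm s1 s1).tsum_add
    (summable_mul_of_summable_norm s2 s2)]
  have := tsum_even_sum fun x => t ^ (x.1 ^ 2) * t ^ (x.2 ^ 2)
  refine Eq.trans (tsum_congr fun x => ?_) (this.trans (congrArg _ (tsum_congr fun x => ?_)))
  · rw [neg_zpow_eq, neg_zpow_eq t, neg_one_zpow_sq, neg_one_zpow_sq, zpow_add₀ (by norm_num)]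
    ring
  · rw [← zpow_add₀ ht0, ← zpow_natCast, ← zpow_mul, ← zpow_mul, ← zpow_add₀ ht0]
    congr 1; push_cast; ring

theorem phi_mul_phi_neg {t : ℂ} (ht0 : t ≠ 0) (ht : ‖t‖ < 1) :
    phi t * phi (-t) = phi (-t ^ 2) ^ 2 := by
  have s1 := summable_norm_zpow_sq ht0 ht
  have s2 := summable_norm_zpow_sq (neg_ne_zero.mpr ht0) (by rwa [norm_neg])
  have s3 := summable_norm_zpow_sq (neg_ne_zero.mpr (pow_ne_zero 2 ht0))
    (by rw [norm_neg]; exact norm_sq_lt_one ht)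
  refine mul_left_cancel₀ (two_ne_zero' ℂ) ?_
  -- Symmetrising makes the sign (-1)^m + (-1)^n = (-1)^n (1 + (-1)^(m+n)), the weight of
  -- `tsum_even_sum`.
  have e : 2 * (phi t * phi (-t)) = phi t * phi (-t) + phi (-t) * phi t := by ring
  rw [e]
  simp only [phi_eq_tsum, pow_two (tsum _)]
  rw [tsum_mul_tsum_of_summable_norm s1 s2, tsum_mul_tsum_of_summable_norm s2 s1,
    tsum_mul_tsum_of_summable_norm s3 s3, ← (summable_mul_of_summable_norm s1 s2).tsum_add
    (summable_mul_of_summable_norm s2 s1)]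
  have := tsum_even_sum fun x => (-1) ^ x.2 * (t ^ (x.1 ^ 2) * t ^ (x.2 ^ 2))
  refine Eq.trans (tsum_congr fun x => ?_) (this.trans (congrArg _ (tsum_congr fun x => ?_)))
  · rw [neg_zpow_eq, neg_zpow_eq t, neg_one_zpow_sq, neg_one_zpow_sq, zpow_add₀ (by norm_num)]
    have : ((-1 : ℂ) ^ x.2) * (-1) ^ x.2 = 1 := by rw [← mul_zpow]; norm_num
    linear_combination (-t ^ (x.1 ^ 2) * t ^ (x.2 ^ 2) * (-1) ^ x.1) * this
  · dsimp only
    have h1 : ((-1 : ℂ) ^ x.2)⁻¹ = (-1) ^ x.2 := by rw [← inv_zpow]; norm_num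
    rw [neg_zpow_eq (t ^ 2), neg_zpow_eq (t ^ 2), neg_one_zpow_sq, neg_one_zpow_sq,
      zpow_sub₀ (by norm_num : (-1 : ℂ) ≠ 0), div_eq_mul_inv, h1, ← zpow_add₀ ht0]
    have h2 : (t ^ 2) ^ (x.1 ^ 2) * (t ^ 2) ^ (x.2 ^ 2)
        = t ^ ((x.1 + x.2) ^ 2 + (x.1 - x.2) ^ 2) := by
      rw [← zpow_natCast, ← zpow_mul, ← zpow_mul, ← zpow_add₀ ht0]
      congr 1; push_cast; ring
    rw [← h2]; ring

theorem phi_ne_zero {t : ℂ} (ht0 : t ≠ 0) (ht : ‖t‖ < 1) : phi t ≠ 0 := f_ne_zero ht0 ht0 ht ht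

/-! ### The product Γ₁Γ₂. -/

theorem prod_odd_four (x : ℂ) (N : ℕ) :
    ∏ k ∈ Finset.range N, ((1 + x * (x ^ 4) ^ k) * (1 + x ^ 3 * (x ^ 4) ^ k))
      = ∏ k ∈ Finset.range (2 * N), (1 + x * (x ^ 2) ^ k) := by
  induction N with
  | zero => simp
  | succ N ih =>
    rw [Finset.prod_range_succ, ih, mul_add_one]
    simp only [Finset.prod_range_succ]
    ring

/-- The odd exponents are sorted by their residues 1, 9, 3, 7, 5 modulo 10. -/
theorem prod_odd_ten (x : ℂ) (N : ℕ) :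
    (∏ k ∈ Finset.range N, ((1 + x * (x ^ 10) ^ k) * (1 + x ^ 9 * (x ^ 10) ^ k)))
      * (∏ k ∈ Finset.range N, ((1 + x ^ 3 * (x ^ 10) ^ k) * (1 + x ^ 7 * (x ^ 10) ^ k)))
      * ∏ k ∈ Finset.range N, (1 + x ^ 5 * ((x ^ 5) ^ 2) ^ k)
      = ∏ k ∈ Finset.range (5 * N), (1 + x * (x ^ 2) ^ k) := by
  induction N with
  | zero => simp
  | succ N ih =>
    rw [mul_add_one]
    simp only [Finset.prod_range_succ, ← ih]
    ring

theorem norm_pow_lt_one {q : ℂ} (hq : ‖q‖ < 1) {n : ℕ} (hn : n ≠ 0) : ‖q ^ n‖ < 1 := by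
  rw [norm_pow]; exact pow_lt_one₀ (norm_nonneg _) hq hn

theorem psi_ne_zero {q : ℂ} (hq0 : q ≠ 0) (hq : ‖q‖ < 1) : psi q ≠ 0 :=
  f_ne_zero hq0 (pow_ne_zero 3 hq0) hq (norm_pow_lt_one hq (by norm_num))

/-- The constant depends on `q` only through `q²`. -/
theorem exists_theta_mul_theta_mul_psi {q : ℂ} (hq0 : q ≠ 0) (hq : ‖q‖ < 1) :
    ∃ c : ℂ, ∀ x : ℂ, x ^ 2 = q ^ 2 →
      f x (x ^ 9) * f (x ^ 3) (x ^ 7) * psi (x ^ 5) = c * psi x := by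
  obtain ⟨a, ha, h4⟩ := exists_tendsto_prod_theta (norm_pow_lt_one hq (n := 4) (by norm_num))
  obtain ⟨b, hb, h10⟩ := exists_tendsto_prod_theta (norm_pow_lt_one hq (n := 10) (by norm_num))
  obtain ⟨d, hd, h20⟩ := exists_tendsto_prod_theta (norm_pow_lt_one hq (n := 20) (by norm_num))
  -- The triple product constants a, b, d belong to the moduli x^4, x^10, x^20, which are powers of
  -- x^2. The relation itself computes ∏ (1 + x^(2k+1)) in two ways.
  refine ⟨a / (b ^ 2 * d), fun x hx => ?_⟩
  have hx0 : x ≠ 0 := by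
    rintro rfl
    exact pow_ne_zero 2 hq0 (by rw [← hx]; norm_num)
  have hxn : ‖x‖ < 1 := by
    have : ‖x‖ ^ 2 = ‖q‖ ^ 2 := by rw [← norm_pow, hx, norm_pow]
    rwa [(pow_left_inj₀ (norm_nonneg _) (norm_nonneg _) (by norm_num)).mp this]
  have e4 : x ^ 4 = q ^ 4 := by linear_combination (x ^ 2 + q ^ 2) * hx
  have e10 : x ^ 10 = q ^ 10 := by
    rw [show x ^ 10 = (x ^ 2) ^ 5 by ring, hx]; ring
  have e20 : (x ^ 5) ^ 4 = q ^ 20 := by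
    rw [show (x ^ 5) ^ 4 = (x ^ 2) ^ 10 by ring, hx]; ring
  rw [← e4] at h4
  rw [← e10] at h10
  rw [← e20] at h20
  obtain ⟨o, ho, hlim⟩ := exists_tendsto_prod (norm_sq_lt_one hxn)
    (one_add_mul_pow_ne_zero hxn (norm_sq_lt_one hxn))
  have hx5 := norm_pow_lt_one hxn (n := 5) (by norm_num)
  obtain ⟨o₅, ho₅, hlim₅⟩ := exists_tendsto_prod (norm_sq_lt_one hx5)
    (one_add_mul_pow_ne_zero hx5 (norm_sq_lt_one hx5))
  have t2 : Tendsto (fun N : ℕ => 2 * N) atTop atTop :=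
    tendsto_id.const_mul_atTop' (by norm_num)
  have t5 : Tendsto (fun N : ℕ => 5 * N) atTop atTop :=
    tendsto_id.const_mul_atTop' (by norm_num)
  have k1 : a * psi x = o := by
    have := h4 x (x ^ 3) hx0 (pow_ne_zero _ hx0) (by ring)
    simp only [prod_odd_four] at this
    exact tendsto_nhds_unique this (hlim.comp t2)
  have k2 : d * psi (x ^ 5) = o₅ := by
    have := h20 (x ^ 5) ((x ^ 5) ^ 3) (pow_ne_zero _ hx0) (pow_ne_zero _ (pow_ne_zero _ hx0))
      (by ring)
    simp only [prod_odd_four] at this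
    exact tendsto_nhds_unique this (hlim₅.comp t2)
  have k3 : b * f x (x ^ 9) * (b * f (x ^ 3) (x ^ 7)) * o₅ = o := by
    have := ((h10 x (x ^ 9) hx0 (pow_ne_zero _ hx0) (by ring)).mul
      (h10 (x ^ 3) (x ^ 7) (pow_ne_zero _ hx0) (pow_ne_zero _ hx0) (by ring))).mul hlim₅
    simp only [prod_odd_ten] at this
    exact tendsto_nhds_unique this (hlim.comp t5)
  rw [← k1, ← k2] at k3
  field_simp
  linear_combination k3

/-- The relation of `exists_theta_mul_theta_mul_psi` at x = q is compared with that at x = -q; the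
common constant drops out. -/
theorem Gamma_mul_Gamma {q : ℂ} (hq0 : q ≠ 0) (hq : ‖q‖ < 1) :
    Gamma₁ q * Gamma₂ q = psi q * psi (-q ^ 5) / (psi (-q) * psi (q ^ 5)) := by
  obtain ⟨c, hc⟩ := exists_theta_mul_theta_mul_psi hq0 hq
  have h1 := hc q rfl
  have h2 := hc (-q) (by ring)
  have e : ∀ n : ℕ, Odd n → (-q) ^ n = -q ^ n := fun n hn => hn.neg_pow q
  rw [e 9 (by decide), e 3 (by decide), e 7 (by decide), e 5 (by decide)] at h2
  have hqn : ‖-q‖ < 1 := by rwa [norm_neg]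
  have hn : ∀ {n : ℕ}, n ≠ 0 → ‖-q ^ n‖ < 1 := fun hn => by
    rw [norm_neg]; exact norm_pow_lt_one hq hn
  have hz : ∀ n : ℕ, -q ^ n ≠ 0 := fun n => neg_ne_zero.mpr (pow_ne_zero n hq0)
  have n1 : f (-q) (-q ^ 9) ≠ 0 :=
    f_ne_zero (neg_ne_zero.mpr hq0) (hz 9) hqn (hn (by norm_num))
  have n2 : f (-q ^ 3) (-q ^ 7) ≠ 0 := f_ne_zero (hz 3) (hz 7) (hn (by norm_num)) (hn (by norm_num))
  have n3 := psi_ne_zero (neg_ne_zero.mpr hq0) hqn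
  have n4 := psi_ne_zero (pow_ne_zero 5 hq0) (norm_pow_lt_one hq (by norm_num))
  unfold Gamma₁ Gamma₂
  rw [div_mul_div_comm, div_eq_div_iff (mul_ne_zero n1 n2) (mul_ne_zero n3 n4)]
  linear_combination psi (-q) * h1 - psi q * h2

/-! ### Bilateral Lambert series and their convergence. -/

/-- The coefficients of the bilateral Lambert series `∑ 2 z^n / (1 + p^n)`. -/
noncomputable def lambertCoeff (p : ℂ) (n : ℤ) : ℂ := 2 / (1 + p ^ n)

/-- The bilateral Lambert series `∑_{n ∈ ℤ} 2 z^n / (1 + p^n)`, for `|p| < |z| < 1`. -/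
noncomputable def lambert (z p : ℂ) : ℂ := ∑' n : ℤ, z ^ n * lambertCoeff p n

theorem zpow_ne_of_norm_one {p w : ℂ} (hp : ‖p‖ < 1) (hw : ‖w‖ = 1) {n : ℤ}
    (hn : n ≠ 0) : p ^ n ≠ w := by
  intro h
  have h1 : ‖p‖ ^ n = 1 := by rw [← norm_zpow, h, hw]
  rcases (zpow_eq_one_iff_of_ne_zero₀ hn).mp h1 with h2 | ⟨h2, -⟩
  · exact hp.ne h2
  · linarith [norm_nonneg p]

theorem one_add_zpow_ne_zero {p : ℂ} (hp : ‖p‖ < 1) (n : ℤ) : 1 + p ^ n ≠ 0 := by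
  rcases eq_or_ne n 0 with rfl | hn
  · norm_num
  · intro h
    exact zpow_ne_of_norm_one hp (w := -1) (by simp) hn (by linear_combination h)

theorem one_sub_zpow_ne_zero {p : ℂ} (hp : ‖p‖ < 1) {n : ℤ} (hn : n ≠ 0) :
    1 - p ^ n ≠ 0 := fun h =>
  zpow_ne_of_norm_one hp (w := 1) (by simp) hn (by linear_combination -h)

theorem lambertCoeff_zero (p : ℂ) : lambertCoeff p 0 = 1 := by norm_num [lambertCoeff]

theorem lambertCoeff_neg {p : ℂ} (hp0 : p ≠ 0) (hp : ‖p‖ < 1) (n : ℤ) :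
    lambertCoeff p (-n) = p ^ n * lambertCoeff p n := by
  have h1 := one_add_zpow_ne_zero hp n
  have h2 := one_add_zpow_ne_zero hp (-n)
  unfold lambertCoeff
  rw [← mul_div_assoc, div_eq_div_iff h2 h1, zpow_neg]
  have h3 := zpow_ne_zero n hp0
  field_simp
  exact add_comm _ _

theorem lambertCoeff_add_neg {p : ℂ} (hp0 : p ≠ 0) (hp : ‖p‖ < 1) (n : ℤ) :
    lambertCoeff p n + lambertCoeff p (-n) = 2 := by
  have h1 := one_add_zpow_ne_zero hp n
  rw [lambertCoeff_neg hp0 hp, lambertCoeff]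
  field_simp

theorem norm_lambertCoeff_natCast_le {p : ℂ} (hp : ‖p‖ < 1) (n : ℕ) :
    ‖lambertCoeff p n‖ ≤ 2 / (1 - ‖p‖) := by
  have h0 : 0 < 1 - ‖p‖ := by linarith
  rcases n with _ | n
  · rw [Nat.cast_zero, lambertCoeff_zero, norm_one, le_div_iff₀ h0]
    linarith [norm_nonneg p]
  · rw [lambertCoeff, norm_div, zpow_natCast]
    simp only [Complex.norm_ofNat]
    gcongr
    have h1 : ‖p ^ (n + 1)‖ ≤ ‖p‖ := by
      rw [norm_pow]
      exact pow_le_of_le_one (norm_nonneg _) hp.le (by omega)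
    have h2 := norm_sub_le (1 + p ^ (n + 1)) (p ^ (n + 1))
    rw [add_sub_cancel_right, norm_one] at h2
    linarith

theorem norm_lambertCoeff_neg_natCast_le {p : ℂ} (hp0 : p ≠ 0) (hp : ‖p‖ < 1) (n : ℕ) :
    ‖lambertCoeff p (-n)‖ ≤ 2 / (1 - ‖p‖) * ‖p‖ ^ n := by
  rw [lambertCoeff_neg hp0 hp, norm_mul, zpow_natCast, norm_pow, mul_comm]
  gcongr
  exact norm_lambertCoeff_natCast_le hp n

theorem norm_lambertCoeff_le {p : ℂ} (hp0 : p ≠ 0) (hp : ‖p‖ < 1) (n : ℤ) :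
    ‖lambertCoeff p n‖ ≤ 2 / (1 - ‖p‖) := by
  rcases Int.eq_nat_or_neg n with ⟨k, rfl | rfl⟩
  · exact norm_lambertCoeff_natCast_le hp k
  · refine (norm_lambertCoeff_neg_natCast_le hp0 hp k).trans (mul_le_of_le_one_right ?_ ?_)
    · exact div_nonneg (by norm_num) (by linarith)
    · exact pow_le_one₀ (norm_nonneg _) hp.le

/-- Coefficients are bounded for n ≥ 0 and of size |p|^|n| for n < 0, so the two halves are
dominated by geometric series in |z| and |p/z|. -/
theorem summable_lambert {z p : ℂ} (hp0 : p ≠ 0) (hzp : ‖p‖ < ‖z‖) (hz : ‖z‖ < 1) :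
    Summable fun n : ℤ => ‖z ^ n * lambertCoeff p n‖ := by
  have hp : ‖p‖ < 1 := hzp.trans hz
  have hz0 : 0 < ‖z‖ := (norm_nonneg _).trans_lt hzp
  refine Summable.of_nat_of_neg ?_ ?_
  · refine Summable.of_nonneg_of_le (fun _ => norm_nonneg _) (fun n => ?_)
      ((summable_geometric_of_lt_one (norm_nonneg _) hz).mul_right (2 / (1 - ‖p‖)))
    rw [norm_mul, zpow_natCast, norm_pow]
    gcongr
    exact norm_lambertCoeff_natCast_le hp n
  · have h1 : ‖p‖ / ‖z‖ < 1 := (div_lt_one hz0).mpr hzp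
    refine Summable.of_nonneg_of_le (fun _ => norm_nonneg _) (fun n => ?_)
      ((summable_geometric_of_lt_one (by positivity) h1).mul_left (2 / (1 - ‖p‖)))
    rw [norm_mul, zpow_neg, zpow_natCast, norm_inv, norm_pow, div_pow]
    calc (‖z‖ ^ n)⁻¹ * ‖lambertCoeff p (-n)‖
        ≤ (‖z‖ ^ n)⁻¹ * (2 / (1 - ‖p‖) * ‖p‖ ^ n) := by
          gcongr; exact norm_lambertCoeff_neg_natCast_le hp0 hp n
      _ = _ := by ring

/-- Product of two bilateral power series. -/
theorem hasSum_laurent_mul {z : ℂ} (hz : z ≠ 0) {a b : ℤ → ℂ}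
    (ha : Summable fun n : ℤ => ‖z ^ n * a n‖) (hb : Summable fun n : ℤ => ‖z ^ n * b n‖) :
    HasSum (fun N : ℤ => z ^ N * ∑' n : ℤ, a (N - n) * b n)
      ((∑' n : ℤ, z ^ n * a n) * ∑' n : ℤ, z ^ n * b n) := by
  have hs := summable_mul_of_summable_norm ha hb
  let e : ℤ × ℤ ≃ ℤ × ℤ :=
    { toFun := fun x => (x.1 - x.2, x.2)
      invFun := fun x => (x.1 + x.2, x.2)
      left_inv := fun x => by simp
      right_inv := fun x => by simp }
  have h1 : HasSum (fun x : ℤ × ℤ => z ^ x.1 * (a (x.1 - x.2) * b x.2))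
      ((∑' n : ℤ, z ^ n * a n) * ∑' n : ℤ, z ^ n * b n) := by
    rw [tsum_mul_tsum_of_summable_norm ha hb]
    have := e.hasSum_iff.mpr hs.hasSum
    refine this.congr_fun fun x => ?_
    have : z ^ x.1 = z ^ (x.1 - x.2) * z ^ x.2 := by rw [← zpow_add₀ hz]; simp
    simp only [e, Function.comp, Equiv.coe_fn_mk]
    rw [this]; ring
  refine h1.prod_fiberwise fun N => ?_
  have h2 := (h1.summable.prod_factor N).hasSum
  simp only [tsum_mul_left] at h2
  exact h2

/-! ### The theta quotient as a Lambert series -/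

theorem thetaTerm_one_add_one {p : ℂ} (hp0 : p ≠ 0) (n : ℤ) :
    thetaTerm 1 p (n + 1) = p ^ n * thetaTerm 1 p n := by
  simpa using thetaTerm_add_one one_ne_zero hp0 n

theorem thetaTerm_div {z p : ℂ} (hz : z ≠ 0) (n : ℤ) :
    thetaTerm z (p / z) n = z ^ n * thetaTerm 1 p n := by
  unfold thetaTerm
  have := tri_succ n
  rw [mul_comm (n + 1) n] at this
  rw [div_zpow, one_zpow, one_mul, this, zpow_add₀ hz]
  have := zpow_ne_zero (n * (n - 1) / 2) hz
  field_simp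

theorem thetaTerm_one_sub (p : ℂ) (n : ℤ) : thetaTerm 1 p (1 - n) = thetaTerm 1 p n := by
  unfold thetaTerm
  rw [one_zpow, one_zpow]
  congr 3; ring

/-- The coefficients `(-1)^n p^{n(n-1)/2}` of `f(-z, -p/z)`. -/
noncomputable def altCoeff (p : ℂ) (n : ℤ) : ℂ := (-1) ^ n * thetaTerm 1 p n

theorem altCoeff_add_one {p : ℂ} (hp0 : p ≠ 0) (n : ℤ) :
    altCoeff p (n + 1) = -(p ^ n * altCoeff p n) := by
  rw [altCoeff, altCoeff, thetaTerm_one_add_one hp0, zpow_add_one₀ (by norm_num)]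
  ring

theorem altCoeff_one_sub (p : ℂ) (n : ℤ) : altCoeff p (1 - n) = -altCoeff p n := by
  have h1 : ((-1 : ℂ) ^ n)⁻¹ = (-1) ^ n := by rw [← inv_zpow]; norm_num
  rw [altCoeff, altCoeff, thetaTerm_one_sub, zpow_sub₀ (by norm_num), div_eq_mul_inv, h1]
  ring

theorem summable_norm_altCoeff {p : ℂ} (hp : ‖p‖ < 1) : Summable fun n : ℤ => ‖altCoeff p n‖ := by
  simpa [altCoeff] using (summable_thetaTerm (r := 1) (s := p) (by rwa [one_mul])).norm

/-- This is the zero of f(-z, -p/z) at z = 1: the reflection n ↦ 1 - n reverses every sign. -/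
theorem tsum_altCoeff (p : ℂ) : ∑' n : ℤ, altCoeff p n = 0 := by
  have h : ∑' n : ℤ, altCoeff p n = -∑' n : ℤ, altCoeff p n := by
    rw [← tsum_neg, ← (Equiv.subLeft (1 : ℤ)).tsum_eq]
    exact tsum_congr fun n => by rw [Equiv.subLeft_apply, altCoeff_one_sub]
  linear_combination h / 2

/-- The coefficients of the product of `f(-z, -p/z)` with the Lambert series. -/
theorem convolution_add_one {p : ℂ} (hp0 : p ≠ 0) (hp : ‖p‖ < 1) (N : ℤ) :
    ∑' n : ℤ, altCoeff p (N + 1 - n) * lambertCoeff p n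
      = p ^ N * ∑' n : ℤ, altCoeff p (N - n) * lambertCoeff p n := by
  have hs : Summable fun n : ℤ => ‖altCoeff p (N + 1 - n)‖ :=
    (Equiv.subLeft (N + 1)).summable_iff (f := fun n => ‖altCoeff p n‖) |>.mpr
      (summable_norm_altCoeff hp)
  have h0 : ∑' n : ℤ, altCoeff p (N + 1 - n) = 0 :=
    ((Equiv.subLeft (N + 1)).tsum_eq (altCoeff p)).trans (tsum_altCoeff p)
  have hs2 : Summable fun n : ℤ => altCoeff p (N + 1 - n) * lambertCoeff p n := by
    refine .of_norm_bounded (hs.mul_right (2 / (1 - ‖p‖))) fun n => ?_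
    rw [norm_mul]
    exact mul_le_mul_of_nonneg_left (norm_lambertCoeff_le hp0 hp n) (norm_nonneg _)
  rw [← tsum_mul_left]
  -- Split p^N as p^(N-n) p^n: one factor shifts the theta coefficient, the other turns λ_n into 2 -
  -- λ_n. The stray 2 disappears because the theta coefficients sum to zero.
  have key : ∀ n : ℤ, p ^ N * (altCoeff p (N - n) * lambertCoeff p n)
      = altCoeff p (N + 1 - n) * lambertCoeff p n - 2 * altCoeff p (N + 1 - n) := by
    intro n
    have h1 : p ^ N = p ^ (N - n) * p ^ n := by rw [← zpow_add₀ hp0, sub_add_cancel]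
    have h2 : p ^ n * lambertCoeff p n = 2 - lambertCoeff p n := by
      rw [← lambertCoeff_neg hp0 hp]
      linear_combination lambertCoeff_add_neg hp0 hp n
    rw [add_sub_right_comm, altCoeff_add_one hp0, h1]
    linear_combination (p ^ (N - n) * altCoeff p (N - n)) * h2
  rw [tsum_congr key, hs2.tsum_sub (hs.of_norm.mul_left 2), tsum_mul_left, h0]
  ring

theorem convolution_eq {p : ℂ} (hp0 : p ≠ 0) (hp : ‖p‖ < 1) (N : ℤ) :
    ∑' n : ℤ, altCoeff p (N - n) * lambertCoeff p n
      = thetaTerm 1 p N * ∑' n : ℤ, altCoeff p (0 - n) * lambertCoeff p n := by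
  induction N using Int.induction_on with
  | zero => rw [thetaTerm_zero, one_mul]
  | succ N ih => rw [convolution_add_one hp0 hp, ih, thetaTerm_one_add_one hp0]; ring
  | pred N ih =>
    have h1 := convolution_add_one hp0 hp (-(N : ℤ) - 1)
    have h2 := thetaTerm_one_add_one hp0 (-(N : ℤ) - 1)
    rw [sub_add_cancel] at h1 h2
    rw [ih, h2] at h1
    refine mul_left_cancel₀ (zpow_ne_zero (-(N : ℤ) - 1) hp0) ?_
    rw [← h1]; ring

theorem exists_theta_mul_lambert {p : ℂ} (hp0 : p ≠ 0) (hp : ‖p‖ < 1) :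
    ∃ c : ℂ, ∀ z : ℂ, ‖p‖ < ‖z‖ → ‖z‖ < 1 →
      f (-z) (-(p / z)) * lambert z p = c * f z (p / z) := by
  refine ⟨∑' n : ℤ, altCoeff p (0 - n) * lambertCoeff p n, fun z hzp hz => ?_⟩
  have hz0 : z ≠ 0 := norm_pos_iff.mp ((norm_nonneg _).trans_lt hzp)
  have e : ∀ n : ℤ, thetaTerm (-z) (-(p / z)) n = z ^ n * altCoeff p n := by
    intro n
    rw [← div_neg, thetaTerm_div (neg_ne_zero.mpr hz0), neg_eq_neg_one_mul, mul_zpow, altCoeff]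
    ring
  have hs : Summable fun n : ℤ => ‖z ^ n * altCoeff p n‖ := by
    simp only [← e]
    refine (summable_thetaTerm ?_).norm
    rwa [neg_mul_neg, mul_div_cancel₀ _ hz0]
  have := (hasSum_laurent_mul hz0 hs (summable_lambert hp0 hzp hz)).tsum_eq
  rw [f, f, tsum_congr e, lambert, ← this, ← tsum_mul_left]
  refine tsum_congr fun N => ?_
  rw [convolution_eq hp0 hp, thetaTerm_div hz0]
  ring

/-! ### The square of the Lambert series -/

theorem hasSum_sub_succ {v : ℕ → ℂ} (hv : Summable v) :
    HasSum (fun n => v n - v (n + 1)) (v 0) := by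
  have := hv.hasSum.sub ((hasSum_nat_add_iff' 1).mpr hv.hasSum)
  simpa using this

/-- The coefficients go from 0 at -∞ to 2 at +∞; by λ_n + λ_{-n} = 2 each half telescopes to λ_0 =
1. -/
theorem hasSum_lambertCoeff_sub_one {p : ℂ} (hp0 : p ≠ 0) (hp : ‖p‖ < 1) :
    HasSum (fun n : ℤ => lambertCoeff p (n + 1) - lambertCoeff p n) 2 := by
  have hs : Summable fun n : ℕ => lambertCoeff p (-n) :=
    .of_norm_bounded ((summable_geometric_of_lt_one (norm_nonneg _) hp).mul_left _)
      (norm_lambertCoeff_neg_natCast_le hp0 hp)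
  have h := hasSum_sub_succ hs
  simp only [Nat.cast_zero, neg_zero, lambertCoeff_zero] at h
  rw [show (2 : ℂ) = 1 + 1 by norm_num]
  refine HasSum.of_nat_of_neg_add_one ?_ ?_
  · convert h using 2 with n
    have h1 := lambertCoeff_add_neg hp0 hp n
    have h2 := lambertCoeff_add_neg hp0 hp ((n + 1 : ℕ) : ℤ)
    push_cast at h2 ⊢
    linear_combination h2 - h1
  · convert h using 2 with n
    congr 2
    ring

theorem hasSum_lambertCoeff_sub {p : ℂ} (hp0 : p ≠ 0) (hp : ‖p‖ < 1) (N : ℤ) :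
    HasSum (fun n : ℤ => lambertCoeff p (n + N) - lambertCoeff p n) (2 * N) := by
  have h1 : ∀ N : ℤ, HasSum (fun n : ℤ => lambertCoeff p (n + N + 1) - lambertCoeff p (n + N)) 2 :=
    fun N => (Equiv.addRight N).hasSum_iff (f := fun n : ℤ => lambertCoeff p (n + 1)
      - lambertCoeff p n) |>.mpr (hasSum_lambertCoeff_sub_one hp0 hp)
  induction N using Int.induction_on with
  | zero => simp
  | succ N ih =>
    have h := (h1 N).add ih
    rw [show (2 : ℂ) + 2 * ((N : ℤ) : ℂ) = 2 * (((N : ℤ) + 1 : ℤ) : ℂ) by push_cast; ring] at h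
    refine h.congr_fun fun n => ?_
    rw [← add_assoc]; ring
  | pred N ih =>
    have h := ih.sub (h1 (-(N : ℤ) - 1))
    rw [show 2 * ((-(N : ℤ) : ℤ) : ℂ) - 2 = 2 * ((-(N : ℤ) - 1 : ℤ) : ℂ) by push_cast; ring] at h
    refine h.congr_fun fun n => ?_
    rw [show n + (-(N : ℤ) - 1) + 1 = n + -N by ring]; ring

/-- Partial fractions give λ_{N-n} λ_n = 2 (λ_n - λ_{n-N}) / (1 - p^N), and the differences
telescope to 2N. -/
theorem tsum_lambertCoeff_mul {p : ℂ} (hp0 : p ≠ 0) (hp : ‖p‖ < 1) {N : ℤ} (hN : N ≠ 0) :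
    ∑' n : ℤ, lambertCoeff p (N - n) * lambertCoeff p n = 4 * N / (1 - p ^ N) := by
  have h := (((Equiv.subRight N).hasSum_iff.mpr (hasSum_lambertCoeff_sub hp0 hp N)).mul_left
    (2 / (1 - p ^ N))).tsum_eq
  rw [show 4 * (N : ℂ) / (1 - p ^ N) = 2 / (1 - p ^ N) * (2 * N) by ring, ← h]
  refine tsum_congr fun n => ?_
  have h0 := one_sub_zpow_ne_zero hp hN
  have h1 := one_add_zpow_ne_zero hp n
  have h2 := one_add_zpow_ne_zero hp (n - N)
  have h3 := one_add_zpow_ne_zero hp (N - n)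
  simp only [Function.comp, Equiv.subRight_apply, sub_add_cancel, lambertCoeff]
  have e1 : p ^ N = p ^ n * p ^ (N - n) := by rw [← zpow_add₀ hp0]; congr 1; ring
  have e2 : p ^ (n - N) = (p ^ (N - n))⁻¹ := by rw [← zpow_neg]; congr 1; ring
  rw [e2] at h2 ⊢
  rw [e1] at h0 ⊢
  have h4 := zpow_ne_zero (N - n) hp0
  generalize p ^ (N - n) = y at *
  generalize p ^ n = x at *
  have h5 : y + 1 ≠ 0 := by rwa [add_comm]
  have h6 : 1 - y * x ≠ 0 := by rwa [mul_comm]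
  have h7 : 2 / (1 + y⁻¹) = 2 * y / (1 + y) := by
    rw [div_eq_div_iff h2 h3]; field_simp; ring
  rw [h7]
  field_simp
  ring

/-- The summand at `N = 0` is zero. -/
theorem exists_hasSum_lambert_sq {p : ℂ} (hp0 : p ≠ 0) (hp : ‖p‖ < 1) :
    ∃ C : ℂ, ∀ z : ℂ, ‖p‖ < ‖z‖ → ‖z‖ < 1 →
      HasSum (fun N : ℤ => 4 * N * z ^ N / (1 - p ^ N)) (lambert z p ^ 2 - C) := by
  refine ⟨∑' n : ℤ, lambertCoeff p (0 - n) * lambertCoeff p n, fun z hzp hz => ?_⟩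
  have hz0 : z ≠ 0 := norm_pos_iff.mp ((norm_nonneg _).trans_lt hzp)
  have hs := summable_lambert hp0 hzp hz
  -- The coefficient at N = 0, where the partial fractions break down, is free of z and is moved
  -- into C.
  have h := (hasSum_laurent_mul hz0 hs hs).sub
    (hasSum_ite_eq (0 : ℤ) (∑' n : ℤ, lambertCoeff p (0 - n) * lambertCoeff p n))
  rw [← pow_two] at h
  refine h.congr_fun fun N => ?_
  rcases eq_or_ne N 0 with rfl | hN
  · simp
  · rw [tsum_lambertCoeff_mul hp0 hp hN, if_neg hN]; ring

/-! ### Jacobi's two-square theorem and the constant in the theta quotient. -/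

theorem tendsto_tsum_one_of_norm_le {a : ℂ → ℤ → ℂ} (h0 : ∀ x, a x 0 = 1)
    (h : ∀ x : ℂ, x ≠ 0 → ‖x‖ ≤ 1 / 2 → ∀ n, ‖a x n‖ ≤ 4 * ‖x‖ ^ n.natAbs) {u : ℕ → ℂ}
    (hu0 : ∀ k, u k ≠ 0) (hu : Tendsto u atTop (𝓝 0)) :
    Tendsto (fun k => ∑' n : ℤ, a (u k) n) atTop (𝓝 1) := by
  have hev : ∀ᶠ k in atTop, ‖u k‖ ≤ 1 / 2 :=
    hu.norm.eventually (ge_mem_nhds (by rw [norm_zero]; norm_num))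
  have hs : Summable fun n : ℤ => 4 * (1 / 2 : ℝ) ^ n.natAbs := by
    have hg : Summable fun n : ℕ => 4 * (1 / 2 : ℝ) ^ n := summable_geometric_two.mul_left 4
    exact Summable.of_nat_of_neg (by simpa using hg) (by simpa using hg)
  rw [← tsum_ite_eq (0 : ℤ) (fun _ => (1 : ℂ))]
  refine tendsto_tsum_of_dominated_convergence hs ?_ ?_
  · intro n
    rcases eq_or_ne n 0 with rfl | hn
    · simp [h0]
    · rw [if_neg hn]
      refine squeeze_zero_norm' (a := fun k => 4 * ‖u k‖ ^ n.natAbs) ?_ ?_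
      · filter_upwards [hev] with k hk using h _ (hu0 k) hk n
      · have := (hu.norm.pow n.natAbs).const_mul 4
        rwa [norm_zero, zero_pow (Int.natAbs_ne_zero.mpr hn), mul_zero] at this
  · filter_upwards [hev] with k hk n
    refine (h _ (hu0 k) hk n).trans ?_
    gcongr

theorem norm_lambert_sq_summand_le {x : ℂ} (hx0 : x ≠ 0) (hx : ‖x‖ ≤ 1 / 2) (n : ℤ) :
    ‖x ^ n * lambertCoeff (x ^ 2) n‖ ≤ 4 * ‖x‖ ^ n.natAbs := by
  have hp0 : x ^ 2 ≠ 0 := pow_ne_zero 2 hx0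
  have hp2 : ‖x ^ 2‖ ≤ 1 / 2 := by rw [norm_pow]; nlinarith [norm_nonneg x]
  have hp : ‖x ^ 2‖ < 1 := by linarith
  have h4 : 2 / (1 - ‖x ^ 2‖) ≤ 4 := by
    rw [div_le_iff₀ (by linarith)]; linarith
  have key : ∀ k : ℕ, ‖x ^ (k : ℤ) * lambertCoeff (x ^ 2) k‖ ≤ 4 * ‖x‖ ^ k := by
    intro k
    rw [norm_mul, zpow_natCast, norm_pow, mul_comm]
    gcongr
    exact (norm_lambertCoeff_natCast_le hp k).trans h4
  rcases Int.eq_nat_or_neg n with ⟨k, rfl | rfl⟩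
  · simpa using key k
  · have h1 := key k
    rw [Int.natAbs_neg, Int.natAbs_natCast, lambertCoeff_neg hp0 hp, ← mul_assoc]
    have h2 : x ^ (-(k : ℤ)) * (x ^ 2) ^ (k : ℤ) = x ^ (k : ℤ) := by
      rw [← zpow_natCast x 2, ← zpow_mul, ← zpow_add₀ hx0]
      congr 1; push_cast; ring
    rwa [h2]

theorem tendsto_lambert_sq {u : ℕ → ℂ} (hu0 : ∀ k, u k ≠ 0) (hu : Tendsto u atTop (𝓝 0)) :
    Tendsto (fun k => lambert (u k) (u k ^ 2)) atTop (𝓝 1) :=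
  tendsto_tsum_one_of_norm_le (a := fun x n => x ^ n * lambertCoeff (x ^ 2) n)
    (by simp [lambertCoeff_zero]) (fun _ hx0 hx n => norm_lambert_sq_summand_le hx0 hx n) hu0 hu

theorem tendsto_phi {u : ℕ → ℂ} (hu0 : ∀ k, u k ≠ 0) (hu : Tendsto u atTop (𝓝 0)) :
    Tendsto (fun k => phi (u k)) atTop (𝓝 1) := by
  simp only [phi_eq_tsum]
  refine tendsto_tsum_one_of_norm_le (a := fun x n => x ^ (n ^ 2)) (by simp) ?_ hu0 hu
  intro x _ hx n
  have e : n ^ 2 = ((n.natAbs ^ 2 : ℕ) : ℤ) := by push_cast; rw [sq_abs]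
  have h1 : ‖x‖ ^ (n.natAbs ^ 2) ≤ ‖x‖ ^ n.natAbs :=
    pow_le_pow_of_le_one (norm_nonneg x) (by linarith) (Nat.le_self_pow (by norm_num) _)
  have h2 : 0 ≤ ‖x‖ ^ n.natAbs := by positivity
  rw [e, zpow_natCast, norm_pow]
  linarith

theorem norm_sq_lt_norm {t : ℂ} (ht0 : t ≠ 0) (ht : ‖t‖ < 1) : ‖t ^ 2‖ < ‖t‖ := by
  rw [norm_pow, pow_two]
  exact mul_lt_of_lt_one_left (norm_pos_iff.mpr ht0) ht

theorem lambert_add_lambert_neg {t : ℂ} (ht0 : t ≠ 0) (ht : ‖t‖ < 1) :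
    lambert t (t ^ 2) + lambert (-t) (t ^ 2) = 2 * lambert (t ^ 2) ((t ^ 2) ^ 2) := by
  have hp0 := pow_ne_zero 2 ht0
  have s1 := (summable_lambert hp0 (norm_sq_lt_norm ht0 ht) ht).of_norm
  have s2 := (summable_lambert hp0 (z := -t) (by rw [norm_neg]; exact norm_sq_lt_norm ht0 ht)
    (by rwa [norm_neg])).of_norm
  have hinj : Function.Injective fun k : ℤ => 2 * k := fun a b h => by
    simpa using h
  unfold lambert
  rw [← s1.tsum_add s2, ← tsum_mul_left, ← hinj.tsum_eq]
  · refine tsum_congr fun k => ?_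
    have e : ∀ x : ℂ, x ^ (2 * k) = (x ^ 2) ^ k := fun x => by
      rw [zpow_mul]; norm_cast
    rw [(even_two_mul k).neg_zpow, lambertCoeff, lambertCoeff, e, e]
    ring
  · intro n hn
    rcases Int.even_or_odd n with ⟨k, hk⟩ | ho
    · exact ⟨k, by simp only; omega⟩
    · exact absurd (by simp [ho.neg_zpow]) hn

theorem lambert_eq_mul_phi_sq {t c : ℂ} (ht0 : t ≠ 0) (ht : ‖t‖ < 1)
    (hc : phi (-t) * lambert t (t ^ 2) = c * phi t) :
    lambert t (t ^ 2) = c / phi (-t ^ 2) ^ 2 * phi t ^ 2 := by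
  have h1 := phi_ne_zero ht0 ht
  have h2 := phi_ne_zero (neg_ne_zero.mpr ht0) (by rwa [norm_neg])
  rw [← phi_mul_phi_neg ht0 ht]
  field_simp
  linear_combination hc

theorem exists_phi_neg_mul_lambert {t : ℂ} (ht0 : t ≠ 0) (ht : ‖t‖ < 1) :
    ∃ c : ℂ, (∀ z : ℂ, ‖t ^ 2‖ < ‖z‖ → ‖z‖ < 1 →
        f (-z) (-(t ^ 2 / z)) * lambert z (t ^ 2) = c * f z (t ^ 2 / z)) ∧
      phi (-t) * lambert t (t ^ 2) = c * phi t ∧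
      phi t * lambert (-t) (t ^ 2) = c * phi (-t) := by
  obtain ⟨c, hc⟩ := exists_theta_mul_lambert (pow_ne_zero 2 ht0) (norm_sq_lt_one ht)
  have h := norm_sq_lt_norm ht0 ht
  refine ⟨c, hc, ?_, ?_⟩
  · have := hc t h ht
    rwa [show t ^ 2 / t = t by field_simp] at this
  · have := hc (-t) (by rwa [norm_neg]) (by rwa [norm_neg])
    rwa [show t ^ 2 / -t = -t by field_simp, neg_neg] at this

/-- The same multiple relates Λ to φ^2 at t and at -t. Averaging the two relations replaces t by t^2
on both sides. -/
theorem lambert_div_phi_sq {t : ℂ} (ht0 : t ≠ 0) (ht : ‖t‖ < 1) :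
    lambert (t ^ 2) ((t ^ 2) ^ 2) / phi (t ^ 2) ^ 2 = lambert t (t ^ 2) / phi t ^ 2 := by
  obtain ⟨c, -, h1, h2⟩ := exists_phi_neg_mul_lambert ht0 ht
  have k1 := lambert_eq_mul_phi_sq ht0 ht h1
  have k2 := lambert_eq_mul_phi_sq (c := c) (neg_ne_zero.mpr ht0) (by rwa [norm_neg])
    (by rw [neg_neg, neg_sq]; exact h2)
  rw [neg_sq] at k2
  have k3 := lambert_add_lambert_neg ht0 ht
  have k4 := phi_sq_add_phi_neg_sq ht0 ht
  rw [div_eq_div_iff (pow_ne_zero 2 (phi_ne_zero (pow_ne_zero 2 ht0) (norm_sq_lt_one ht)))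
    (pow_ne_zero 2 (phi_ne_zero ht0 ht))]
  have k5 : lambert (t ^ 2) ((t ^ 2) ^ 2) = c / phi (-t ^ 2) ^ 2 * phi (t ^ 2) ^ 2 := by
    linear_combination (-1 / 2) * k3 + (1 / 2) * k1 + (1 / 2) * k2
      + (1 / 2) * (c / phi (-t ^ 2) ^ 2) * k4
  rw [k5, k1]; ring

/-- Jacobi's two-square theorem as a Lambert series. -/
theorem lambert_eq_phi_sq {t : ℂ} (ht0 : t ≠ 0) (ht : ‖t‖ < 1) :
    lambert t (t ^ 2) = phi t ^ 2 := by
  -- The quotient is constant along t^(2^k) → 0, where numerator and denominator both tend to 1.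
  have hiter : ∀ k : ℕ, lambert (t ^ 2 ^ k) ((t ^ 2 ^ k) ^ 2) / phi (t ^ 2 ^ k) ^ 2
      = lambert t (t ^ 2) / phi t ^ 2 := by
    intro k
    induction k with
    | zero => simp
    | succ k ih =>
      rw [← ih, pow_succ 2 k, pow_mul]
      exact lambert_div_phi_sq (pow_ne_zero _ ht0) (norm_pow_lt_one ht (by positivity))
  have hu0 : ∀ k : ℕ, t ^ 2 ^ k ≠ 0 := fun k => pow_ne_zero _ ht0
  have hu : Tendsto (fun k : ℕ => t ^ 2 ^ k) atTop (𝓝 0) :=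
    (tendsto_pow_atTop_nhds_zero_of_norm_lt_one ht).comp
      (tendsto_pow_atTop_atTop_of_one_lt (by norm_num))
  have hlim := (tendsto_lambert_sq hu0 hu).div ((tendsto_phi hu0 hu).pow 2) (by norm_num)
  have h1 := tendsto_nhds_unique (tendsto_const_nhds.congr fun k => (hiter k).symm) hlim
  rw [one_pow, div_one] at h1
  exact (div_eq_one_iff_eq (pow_ne_zero 2 (phi_ne_zero ht0 ht))).mp h1

/-- The choice z = t together with the two-square theorem evaluates the unknown constant as
φ(-t^2)^2. -/
theorem phi_sq_mul_theta {t z w : ℂ} (ht0 : t ≠ 0) (ht : ‖t‖ < 1) (hz : ‖z‖ < 1) (hw : ‖w‖ < 1)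
    (hzw : z * w = t ^ 2) :
    phi (-t ^ 2) ^ 2 * f z w = f (-z) (-w) * lambert z (t ^ 2) := by
  obtain ⟨c, hc, h1, -⟩ := exists_phi_neg_mul_lambert ht0 ht
  have hz0 : z ≠ 0 := by
    rintro rfl
    exact pow_ne_zero 2 ht0 (by rw [← hzw, zero_mul])
  have hzt : ‖t ^ 2‖ < ‖z‖ := by
    rw [← hzw, norm_mul]
    exact mul_lt_of_lt_one_right (norm_pos_iff.mpr hz0) hw
  have h2 := hc z hzt hz
  rw [← hzw, mul_div_cancel_left₀ _ hz0, hzw] at h2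
  have hc' : c = phi (-t ^ 2) ^ 2 := by
    have hne := phi_ne_zero ht0 ht
    refine mul_right_cancel₀ hne ?_
    rw [← h1, lambert_eq_phi_sq ht0 ht, ← phi_mul_phi_neg ht0 ht]; ring
  rw [h2, hc']

/-! ### Evaluation at modulus q^10. -/

theorem zpow_pow_comm (q : ℂ) (k : ℕ) (N : ℤ) : (q ^ k) ^ N = (q ^ N) ^ k := by
  rw [← zpow_natCast, ← zpow_natCast, ← zpow_mul, ← zpow_mul, mul_comm]

theorem norm_pow_lt_norm_pow {q : ℂ} (hq0 : q ≠ 0) (hq : ‖q‖ < 1) {a b : ℕ} (hab : a < b) :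
    ‖q ^ b‖ < ‖q ^ a‖ := by
  rw [norm_pow, norm_pow]
  exact pow_lt_pow_right_of_lt_one₀ (norm_pos_iff.mpr hq0) hq hab

theorem lambert_sub_lambert {q : ℂ} (hq0 : q ≠ 0) (hq : ‖q‖ < 1) :
    2 * (lambert q (q ^ 10) - lambert (q ^ 3) (q ^ 10)) = phi q ^ 2 - phi (q ^ 5) ^ 2 := by
  have hz : ∀ n : ℕ, q ^ n ≠ 0 := fun n => pow_ne_zero n hq0
  have hlt : ∀ {n : ℕ}, n ≠ 0 → ‖q ^ n‖ < 1 := fun hn => norm_pow_lt_one hq hn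
  have hs : ∀ {a b : ℕ}, a ≠ 0 → a < b → HasSum (fun n : ℤ => (q ^ a) ^ n * lambertCoeff (q ^ b) n)
      (lambert (q ^ a) (q ^ b)) := fun ha hab =>
    (summable_lambert (hz _) (norm_pow_lt_norm_pow hq0 hq hab) (hlt ha)).of_norm.hasSum
  have h1 := hs (a := 1) (b := 10) (by norm_num) (by norm_num)
  have h3 := hs (a := 3) (b := 10) (by norm_num) (by norm_num)
  have h5 := hs (a := 5) (b := 10) (by norm_num) (by norm_num)
  have h12 := hs (a := 1) (b := 2) (by norm_num) (by norm_num)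
  have h13 := h1.sub h3
  -- Adding the terms at n and -n yields x - x^3 - x^7 + x^9 over 1 + x^10 with x = q^n; this is the
  -- alternating expansion of x / (1 + x^2) without its x^5 term.
  have hsum := h13.add ((Equiv.neg ℤ).hasSum_iff.mpr h13)
  have e5 := lambert_eq_phi_sq (hz 5) (hlt (by norm_num))
  rw [show (q ^ 5) ^ 2 = q ^ 10 by ring] at e5
  rw [pow_one] at h1 h12 hsum
  rw [← lambert_eq_phi_sq hq0 hq, ← e5, two_mul]
  refine hsum.unique ((h12.sub h5).congr_fun fun n => ?_)
  have hx0 := zpow_ne_zero n hq0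
  have n2 := one_add_zpow_ne_zero (hlt (n := 2) (by norm_num)) n
  have n10 := one_add_zpow_ne_zero (hlt (n := 10) (by norm_num)) n
  simp only [Function.comp, Equiv.neg_apply, lambertCoeff_neg (hz 10) (hlt (by norm_num) :
    ‖q ^ 10‖ < 1)]
  simp only [lambertCoeff, zpow_neg, zpow_pow_comm] at n2 n10 ⊢
  generalize q ^ n = x at *
  have key : 2 / (1 + x ^ 2) = 2 * (1 - x ^ 2 + x ^ 4 - x ^ 6 + x ^ 8) / (1 + x ^ 10) := by
    rw [div_eq_div_iff n2 n10]; ring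
  rw [key]
  field_simp
  ring

theorem hasSum_pnat_of_hasSum_int {F : ℤ → ℂ} {a : ℂ} (h : HasSum F a) (h0 : F 0 = 0) :
    HasSum (fun m : ℕ+ => F (m : ℕ) + F (-(m : ℕ))) a := by
  have h1 := h.nat_add_neg
  rw [h0, add_zero] at h1
  refine (PNat.coe_injective.hasSum_iff (f := fun n : ℕ => F n + F (-n)) ?_).mpr h1
  intro n hn
  rcases Nat.eq_zero_or_pos n with rfl | hpos
  · simp [h0]
  · exact absurd ⟨⟨n, hpos⟩, rfl⟩ hn

theorem hasSum_L {q : ℂ} (hq : ‖q‖ < 1) :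
    HasSum (fun m : ℕ+ => (m : ℂ) * q ^ (m : ℕ) / (1 - q ^ (m : ℕ))) ((1 - L q) / 24) := by
  convert (summable_L hq).hasSum using 1
  rw [L]; ring

/-- The terms ±m of Λ(z)^2 combine to 4m (z^m + (p/z)^m) / (1 - p^m). With x = q^m, both sides have
numerator m (x + x^3 + x^7 + x^9 - 4x^5) over 1 - x^10; the weights 1, 1, -2 remove C. -/
theorem eisenstein_eq_lambert {q : ℂ} (hq0 : q ≠ 0) (hq : ‖q‖ < 1) :
    (1 / 24 : ℂ) * (-L q + L (q ^ 2) + 5 * L (q ^ 5) - 5 * L (q ^ 10))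
      = (lambert q (q ^ 10) ^ 2 + lambert (q ^ 3) (q ^ 10) ^ 2
          - 2 * lambert (q ^ 5) (q ^ 10) ^ 2) / 4 := by
  have hlt : ∀ {n : ℕ}, n ≠ 0 → ‖q ^ n‖ < 1 := fun hn => norm_pow_lt_one hq hn
  have hp0 : q ^ 10 ≠ 0 := pow_ne_zero 10 hq0
  obtain ⟨C, hC⟩ := exists_hasSum_lambert_sq hp0 (hlt (by norm_num))
  have h1 := hC q (by simpa using norm_pow_lt_norm_pow hq0 hq (by norm_num : 1 < 10)) hq
  have h3 := hC (q ^ 3) (norm_pow_lt_norm_pow hq0 hq (by norm_num)) (hlt (by norm_num))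
  have h5 := hC (q ^ 5) (norm_pow_lt_norm_pow hq0 hq (by norm_num)) (hlt (by norm_num))
  have hZ := hasSum_pnat_of_hasSum_int (((h1.add h3).sub (h5.mul_left 2)).mul_left (1 / 4))
    (by simp)
  have hL := (((hasSum_L hq).sub (hasSum_L (hlt (n := 2) (by norm_num)))).sub
    ((hasSum_L (hlt (n := 5) (by norm_num))).mul_left 5)).add
    ((hasSum_L (hlt (n := 10) (by norm_num))).mul_left 5)
  have := hL.unique (hZ.congr_fun fun m => ?_)
  · linear_combination this
  have n1 := one_sub_zpow_ne_zero hq (n := (m : ℕ)) (by simp)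
  have n2 := one_sub_zpow_ne_zero (hlt (n := 2) (by norm_num)) (n := (m : ℕ)) (by simp)
  have n5 := one_sub_zpow_ne_zero (hlt (n := 5) (by norm_num)) (n := (m : ℕ)) (by simp)
  have n10 := one_sub_zpow_ne_zero (hlt (n := 10) (by norm_num)) (n := (m : ℕ)) (by simp)
  have hx0 := pow_ne_zero (m : ℕ) hq0
  simp only [zpow_neg, zpow_natCast, ← pow_mul, mul_comm _ (m : ℕ), Int.cast_neg,
    Int.cast_natCast] at n1 n2 n5 n10 hx0 ⊢
  simp only [pow_mul] at n1 n2 n5 n10 hx0 ⊢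
  generalize q ^ (m : ℕ) = x at *
  generalize ((m : ℕ) : ℂ) = y
  have k1 : y * x / (1 - x)
      = y * (x + x ^ 2 + x ^ 3 + x ^ 4 + x ^ 5 + x ^ 6 + x ^ 7 + x ^ 8 + x ^ 9 + x ^ 10)
        / (1 - x ^ 10) := by
    rw [div_eq_div_iff n1 n10]; ring
  have k2 : y * x ^ 2 / (1 - x ^ 2)
      = y * (x ^ 2 + x ^ 4 + x ^ 6 + x ^ 8 + x ^ 10) / (1 - x ^ 10) := by
    rw [div_eq_div_iff n2 n10]; ring
  have k5 : y * x ^ 5 / (1 - x ^ 5) = y * (x ^ 5 + x ^ 10) / (1 - x ^ 10) := by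
    rw [div_eq_div_iff n5 n10]; ring
  have kn : ∀ w : ℂ, 4 * -y * w / (1 - (x ^ 10)⁻¹) = 4 * y * (w * x ^ 10) / (1 - x ^ 10) := by
    intro w
    have : 1 - (x ^ 10)⁻¹ ≠ 0 := by
      rw [sub_ne_zero, ne_comm, inv_ne_one]
      exact fun h => n10 (by rw [h, sub_self])
    rw [div_eq_div_iff this n10]
    field_simp
    ring
  rw [k1, k2, k5, kn, kn, kn]
  field_simp
  ring

theorem L_zero : L 0 = 1 := by simp [L]

theorem f_zero_zero : f 0 0 = 1 := by
  rw [f, tsum_eq_single 0, thetaTerm_zero]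
  intro n hn
  unfold thetaTerm
  rcases lt_or_gt_of_ne hn with h | h
  · have : 2 * 1 ≤ n * (n - 1) := by nlinarith
    rw [zero_zpow (n * (n - 1) / 2) (by omega), mul_zero]
  · have : 2 * 1 ≤ n * (n + 1) := by nlinarith
    rw [zero_zpow (n * (n + 1) / 2) (by omega), zero_mul]

end RamanujanTheta

theorem mainTheorem5 (q : ℂ) (hq : ‖q‖ < 1) :
    -- the denominators of all the quotients below do not vanish
    (RamanujanTheta.f (-q) (-q ^ 9) ≠ 0 ∧ RamanujanTheta.f (-q ^ 3) (-q ^ 7) ≠ 0 ∧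
      RamanujanTheta.phi (-q ^ 10) ≠ 0 ∧
      RamanujanTheta.psi (-q) ≠ 0 ∧ RamanujanTheta.psi (q ^ 5) ≠ 0) ∧
    -- the identity in terms of `Γ₁² + Γ₂²`
    (1 / 24 : ℂ) * (-RamanujanTheta.L q + RamanujanTheta.L (q ^ 2)
        + 5 * RamanujanTheta.L (q ^ 5) - 5 * RamanujanTheta.L (q ^ 10))
      = -(RamanujanTheta.phi (q ^ 5) ^ 4 / 2)
        + RamanujanTheta.phi (-q ^ 10) ^ 4 / 4
          * (RamanujanTheta.Gamma₁ q ^ 2 + RamanujanTheta.Gamma₂ q ^ 2) ∧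
    -- the explicit form in `φ` and `ψ`
    (1 / 24 : ℂ) * (-RamanujanTheta.L q + RamanujanTheta.L (q ^ 2)
        + 5 * RamanujanTheta.L (q ^ 5) - 5 * RamanujanTheta.L (q ^ 10))
      = -(RamanujanTheta.phi (q ^ 5) ^ 4 / 2)
        + RamanujanTheta.phi (-q ^ 10) ^ 4 / 4
          * (RamanujanTheta.phi q ^ 4 / (4 * RamanujanTheta.phi (-q ^ 10) ^ 4)
            + RamanujanTheta.phi (q ^ 5) ^ 4 / (4 * RamanujanTheta.phi (-q ^ 10) ^ 4)
            - RamanujanTheta.phi q ^ 2 * RamanujanTheta.phi (q ^ 5) ^ 2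
                / (2 * RamanujanTheta.phi (-q ^ 10) ^ 4)
            + 2 * RamanujanTheta.psi q * RamanujanTheta.psi (-q ^ 5)
                / (RamanujanTheta.psi (-q) * RamanujanTheta.psi (q ^ 5))) := by
  -- At q = 0 every theta value and every L equals 1, and the identities are numerical.
  obtain rfl | hq0 := eq_or_ne q 0
  · norm_num [RamanujanTheta.Gamma₁, RamanujanTheta.Gamma₂, RamanujanTheta.phi,
      RamanujanTheta.psi, RamanujanTheta.f_zero_zero, RamanujanTheta.L_zero]
  have hz : ∀ n : ℕ, q ^ n ≠ 0 := fun n => pow_ne_zero n hq0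
  have hlt : ∀ {n : ℕ}, n ≠ 0 → ‖q ^ n‖ < 1 := fun hn => RamanujanTheta.norm_pow_lt_one hq hn
  have hlt' : ∀ {n : ℕ}, n ≠ 0 → ‖-q ^ n‖ < 1 := fun hn => by rw [norm_neg]; exact hlt hn
  have d1 : RamanujanTheta.f (-q) (-q ^ 9) ≠ 0 :=
    RamanujanTheta.f_ne_zero (neg_ne_zero.mpr hq0) (neg_ne_zero.mpr (hz 9)) (by rwa [norm_neg])
      (hlt' (by norm_num))
  have d2 : RamanujanTheta.f (-q ^ 3) (-q ^ 7) ≠ 0 :=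
    RamanujanTheta.f_ne_zero (neg_ne_zero.mpr (hz 3)) (neg_ne_zero.mpr (hz 7))
      (hlt' (by norm_num)) (hlt' (by norm_num))
  have d3 : RamanujanTheta.phi (-q ^ 10) ≠ 0 :=
    RamanujanTheta.phi_ne_zero (neg_ne_zero.mpr (hz 10)) (hlt' (by norm_num))
  have d4 : RamanujanTheta.psi (-q) ≠ 0 :=
    RamanujanTheta.psi_ne_zero (neg_ne_zero.mpr hq0) (by rwa [norm_neg])
  have d5 : RamanujanTheta.psi (q ^ 5) ≠ 0 :=
    RamanujanTheta.psi_ne_zero (hz 5) (hlt (by norm_num))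
  have e10 : (q ^ 5) ^ 2 = q ^ 10 := by ring
  have g1 := RamanujanTheta.phi_sq_mul_theta (z := q) (w := q ^ 9) (hz 5) (hlt (by norm_num)) hq
    (hlt (by norm_num)) (by ring)
  have g2 := RamanujanTheta.phi_sq_mul_theta (z := q ^ 3) (w := q ^ 7) (hz 5) (hlt (by norm_num))
    (hlt (by norm_num)) (hlt (by norm_num)) (by ring)
  have g3 := RamanujanTheta.lambert_eq_phi_sq (hz 5) (hlt (by norm_num))
  rw [e10] at g1 g2 g3
  have k1 : RamanujanTheta.lambert q (q ^ 10)
      = RamanujanTheta.phi (-q ^ 10) ^ 2 * RamanujanTheta.Gamma₁ q := by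
    rw [RamanujanTheta.Gamma₁, ← mul_div_assoc, g1, mul_div_cancel_left₀ _ d1]
  have k2 : RamanujanTheta.lambert (q ^ 3) (q ^ 10)
      = RamanujanTheta.phi (-q ^ 10) ^ 2 * RamanujanTheta.Gamma₂ q := by
    rw [RamanujanTheta.Gamma₂, ← mul_div_assoc, g2, mul_div_cancel_left₀ _ d2]
  have main : (1 / 24 : ℂ) * (-RamanujanTheta.L q + RamanujanTheta.L (q ^ 2)
        + 5 * RamanujanTheta.L (q ^ 5) - 5 * RamanujanTheta.L (q ^ 10))
      = -(RamanujanTheta.phi (q ^ 5) ^ 4 / 2)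
        + RamanujanTheta.phi (-q ^ 10) ^ 4 / 4
          * (RamanujanTheta.Gamma₁ q ^ 2 + RamanujanTheta.Gamma₂ q ^ 2) := by
    rw [RamanujanTheta.eisenstein_eq_lambert hq0 hq, k1, k2, g3]
    ring
  refine ⟨⟨d1, d2, d3, d4, d5⟩, main, ?_⟩
  rw [main]
  congr 2
  have h1 := RamanujanTheta.lambert_sub_lambert hq0 hq
  have h2 := RamanujanTheta.Gamma_mul_Gamma hq0 hq
  rw [k1, k2] at h1
  -- With the ψ quotient replaced by Γ₁Γ₂, what remains is the square of `h1`.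
  rw [mul_assoc 2, mul_div_assoc 2, ← h2]
  field_simp
  linear_combination 2 * (2 * RamanujanTheta.phi (-q ^ 10) ^ 2
    * (RamanujanTheta.Gamma₁ q - RamanujanTheta.Gamma₂ q)
    + (RamanujanTheta.phi q ^ 2 - RamanujanTheta.phi (q ^ 5) ^ 2)) * h1
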